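/- A \emph{potentially degenerate Gaussian mixture model} (pdGMM) on $\mathbb{R}^n$ is a probability measure of the form $\sum_{j=1}^{J}\lambda_j N(\mu_j,\Sigma_j)$ with finitely many components, where $\lambda_j>0$, $\sum_{j=1}^J\lambda_j=1$, $\mu_j\in\mathbb{R}^n$, and $\Sigma_j\in\mathbb{R}^{n\times n}$ is a symmetric positive semidefinite, possibly singular, matrix; here $N(\mu,\Sigma)$ is the Gaussian measure with mean $\mu$ and covariance matrix $\Sigma$. It is in \emph{reduced form} if $(\mu_i,\Sigma_i)\neq(\mu_j,\Sigma_j)$ for all $i\neq j$. \textbf{Theorem (Identifiability of pdGMMs from an open set).} Let $P=\sum_{j=1}^{J}\lambda_j N(\mu_j,\Sigma_j)$ and $P'=\sum_{j=1}^{J'}\lambda'_j N(\mu'_j,\Sigma'_j)$ be two pdGMMs on $\mathbb{R}^n$ in reduced form, with $\operatorname{rank}(\Sigma_j)>0$ for all $j\in\{1,\dots,J\}$ and $\operatorname{rank}(\Sigma'_j)>0$ for all $j\in\{1,\dots,J'\}$. Let $\mathcal{X}_j$ denote the (topological) support of the measure $N(\mu_j,\Sigma_j)$. Suppose that there is an open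 set $E\subseteq\mathbb{R}^n$ such that $\mathcal{X}_j\cap E\neq\emptyset$ for all $j\in\{1,\dots,J\}$, and such that $P(A\cap E)=P'(A\cap E)$ for every Borel set $A\subseteq\mathbb{R}^n$. Then $P=P'$ on all of $\mathbb{R}^n$, $J=J'$, and there is a bijection $\pi:\{1,\dots,J\}\to\{1,\dots,J'\}$ such that $(\lambda_j,\mu_j,\Sigma_j)=(\lambda'_{\pi(j)},\mu'_{\pi(j)},\Sigma'_{\pi(j)})$ for all $j\in\{1,\dots,J\}$. -/

import Mathlib

/-- The parameters of a potentially degenerate Gaussian mixture model (pdGMM)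
`∑ j, λ j • N(μ j, Σ j)` on `ℝⁿ`. The covariance matrices are symmetric positive semidefinite and
may be singular. -/
structure PdGMM (n : ℕ) where
  /-- the number of components -/
  J : ℕ
  /-- the weights `λ j` -/
  weight : Fin J → ℝ
  /-- the means `μ j` -/
  mean : Fin J → EuclideanSpace ℝ (Fin n)
  /-- the covariance matrices `Σ j` -/
  cov : Fin J → Matrix (Fin n) (Fin n) ℝ
  cov_posSemidef : ∀ j, (cov j).PosSemidef
  weight_pos : ∀ j, 0 < weight j
  sum_weight : ∑ j, weight j = 1

namespace PdGMM

/-- The Gaussian measure `N(μ j, Σ j)` of the `j`-th component. -/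
noncomputable def component {n : ℕ} (P : PdGMM n) (j : Fin P.J) :
    MeasureTheory.Measure (EuclideanSpace ℝ (Fin n)) :=
  ProbabilityTheory.multivariateGaussian (P.mean j) (P.cov j)

/-- The distribution `∑ j, λ j • N(μ j, Σ j)` of the mixture. -/
noncomputable def law {n : ℕ} (P : PdGMM n) :
    MeasureTheory.Measure (EuclideanSpace ℝ (Fin n)) :=
  ∑ j, ENNReal.ofReal (P.weight j) • P.component j

/-- The mixture is in reduced form: its components have pairwise distinct parameters. -/
def IsReduced {n : ℕ} (P : PdGMM n) : Prop :=
  ∀ i j, i ≠ j → (P.mean i, P.cov i) ≠ (P.mean j, P.cov j)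

end PdGMM

/-! Subtracting the mixtures gives a signed combination of Gaussians that vanishes on `E`. By
`eq_zero_of_sum_map_stdGaussian_eq_zero`, every Gaussian whose support meets `E` has total
coefficient zero in it. So each component of `P` is cancelled by an equal component of `Q` of the
same weight. These weights already sum to 1, so `Q` has no further component, although its supports
are not assumed to meet `E`.

Supports of different position or dimension are separated by measure: a Gaussian gives no mass to an
affine subspace that does not contain its own (`map_stdGaussian_affineSubspace_eq_zero`).
Restricting to one supporting subspace, minus the strictly smaller ones of the family, isolates the
components that share it. On that subspace they have densities `k * exp (-quadratic)`
(`exists_density_map_stdGaussian`). A combination of these that vanishes on a nonempty open set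
vanishes everywhere by analyticity, and growth along a generic line kills the coefficients. -/

open MeasureTheory ProbabilityTheory Filter Topology
open scoped RealInnerProductSpace

/-! ### Linear independence of exponentials of quadratics -/

/-- Functions `t ↦ exp (α t² + β t)` with pairwise distinct `(α, β)` are linearly independent. -/
theorem eq_zero_of_sum_mul_exp_quadratic_eq_zero {ι : Type*} {s : Finset ι} {α β a : ι → ℝ}
    (hinj : ∀ i ∈ s, ∀ j ∈ s, α i = α j → β i = β j → i = j)
    (h : ∀ t : ℝ, ∑ i ∈ s, a i * Real.exp (α i * t ^ 2 + β i * t) = 0) :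
    ∀ i ∈ s, a i = 0 := by
  classical
  by_contra! hne
  obtain ⟨i₀, hi₀, ha₀⟩ := hne
  -- The lexicographically largest `(α, β)` with nonzero coefficient dominates as `t → ∞`: after
  -- division by its exponential, only `a m` survives in the limit.
  obtain ⟨m, hm, hmax⟩ := Finset.exists_max_image (s.filter (a · ≠ 0))
    (fun i => toLex (α i, β i)) ⟨i₀, by simp [hi₀, ha₀]⟩
  rw [Finset.mem_filter] at hm
  have hterm : ∀ i ∈ s, Tendsto
      (fun t : ℝ => a i * Real.exp ((α i - α m) * t ^ 2 + (β i - β m) * t)) atTop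
      (𝓝 (if i = m then a m else 0)) := by
    intro i hi
    split_ifs with him
    · subst him; simp
    by_cases hai : a i = 0
    · simp [hai]
    rw [← mul_zero (a i)]
    refine (Real.tendsto_exp_atBot.comp ?_).const_mul _
    have hlt := hmax i (by simp [hi, hai])
    rw [Prod.Lex.le_iff] at hlt
    simp only [ofLex_toLex] at hlt
    have hrw : (fun t : ℝ => (α i - α m) * t ^ 2 + (β i - β m) * t) =
        fun t => t * ((α i - α m) * t + (β i - β m)) := by
      ext t; ring
    rw [hrw]
    rcases hlt with hlt | ⟨heq, hle⟩
    · refine tendsto_id.atTop_mul_atBot₀ (tendsto_atBot_add_const_right _ _ ?_)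
      exact tendsto_id.const_mul_atTop_of_neg (sub_neg.2 hlt)
    · have hlt : β i - β m < 0 :=
        sub_neg.2 (lt_of_le_of_ne hle fun hβ => him (hinj i hi m hm.1 heq hβ))
      simp only [heq, sub_self, zero_mul, zero_add]
      exact tendsto_id.atTop_mul_const_of_neg hlt
  have hsum := tendsto_finsetSum s hterm
  have hzero : (fun t : ℝ => ∑ i ∈ s, a i *
      Real.exp ((α i - α m) * t ^ 2 + (β i - β m) * t)) = fun _ => 0 := by
    ext t
    have : ∀ i, a i * Real.exp ((α i - α m) * t ^ 2 + (β i - β m) * t) =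
        a i * Real.exp (α i * t ^ 2 + β i * t) * Real.exp (-(α m * t ^ 2 + β m * t)) := by
      intro i
      rw [mul_assoc, ← Real.exp_add]
      congr 2; ring
    simp_rw [this]
    rw [← Finset.sum_mul, h t, zero_mul]
  rw [hzero] at hsum
  have := tendsto_nhds_unique hsum tendsto_const_nhds
  rw [Finset.sum_ite_eq' s m, if_pos hm.1] at this
  exact hm.2 this

/-- Exponentials of analytic functions that are quadratic along each line and pairwise do not
differ by a constant are linearly independent on every nonempty open set. -/
theorem eq_zero_of_sum_mul_exp_eq_zero_on_open {V ι : Type*} [NormedAddCommGroup V]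
    [NormedSpace ℝ V] {s : Finset ι} {q : ι → V → ℝ} {c : ι → ℝ}
    (hq : ∀ i ∈ s, AnalyticOnNhd ℝ (q i) Set.univ)
    (hquad : ∀ i ∈ s, ∀ x v, ∃ α β γ : ℝ, ∀ t : ℝ, q i (x + t • v) = α * t ^ 2 + β * t + γ)
    (hne : ∀ i ∈ s, ∀ j ∈ s, i ≠ j → ∃ x y, q i x - q j x ≠ q i y - q j y)
    {U : Set V} (hU : IsOpen U) (hUne : U.Nonempty)
    (h : ∀ x ∈ U, ∑ i ∈ s, c i * Real.exp (q i x) = 0) : ∀ i ∈ s, c i = 0 := by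
  classical
  have hall : ∀ x, ∑ i ∈ s, c i * Real.exp (q i x) = 0 := by
    obtain ⟨x₀, hx₀⟩ := hUne
    have hf : AnalyticOnNhd ℝ (fun x => ∑ i ∈ s, c i * Real.exp (q i x)) Set.univ :=
      fun x _ => Finset.analyticAt_fun_sum s fun i hi =>
        analyticAt_const.mul ((hq i hi x trivial).rexp)
    have := hf.eqOn_zero_of_preconnected_of_eventuallyEq_zero isPreconnected_univ
      (Set.mem_univ x₀) (Filter.eventually_of_mem (hU.mem_nhds hx₀) h)
    exact fun x => this (Set.mem_univ x)
  -- A direction `y` in this set separates the values of each `q i - q j` at `0` and `y`, so no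
  -- difference is constant on the line through them. By the identity theorem each pair excludes
  -- only a closed set with empty interior.
  have hd : Dense (⋂ p ∈ (s ×ˢ s).filter (fun p => p.1 ≠ p.2),
      {y | q p.1 y - q p.2 y ≠ q p.1 0 - q p.2 0}) := by
    have hod : ∀ p ∈ (s ×ˢ s).filter (fun p => p.1 ≠ p.2),
        IsOpen {y | q p.1 y - q p.2 y ≠ q p.1 0 - q p.2 0} ∧
          Dense {y | q p.1 y - q p.2 y ≠ q p.1 0 - q p.2 0} := by
      rintro ⟨i, j⟩ hp
      simp only [Finset.mem_filter, Finset.mem_product] at hp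
      obtain ⟨⟨hi, hj⟩, hij⟩ := hp
      have han : AnalyticOnNhd ℝ (fun y => q i y - q j y) Set.univ :=
        (hq i hi).sub (hq j hj)
      refine ⟨isOpen_ne_fun (continuousOn_univ.1 han.continuousOn) continuous_const, ?_⟩
      intro y
      by_contra hy
      obtain ⟨x₁, x₂, hx⟩ := hne i hi j hj hij
      have hev : (fun y => q i y - q j y) =ᶠ[𝓝 y] fun _ => q i 0 - q j 0 := by
        have : ∀ᶠ z in 𝓝 y, z ∈ (closure {y | q i y - q j y ≠ q i 0 - q j 0})ᶜ :=
          isClosed_closure.isOpen_compl.mem_nhds hy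
        filter_upwards [this] with z hz
        by_contra hz'
        exact hz (subset_closure hz')
      have heq := han.eq_of_eventuallyEq analyticOnNhd_const hev
      exact hx ((congrFun heq x₁).trans (congrFun heq x₂).symm)
    revert hod
    generalize (s ×ˢ s).filter (fun p => p.1 ≠ p.2) = F
    intro hod
    induction F using Finset.induction_on with
    | empty => simp
    | insert p F hpF ih =>
      rw [Finset.set_biInter_insert]
      exact (hod p (by simp)).2.inter_of_isOpen_left
        (ih fun r hr => hod r (by simp [hr])) (hod p (by simp)).1
  obtain ⟨v, hv⟩ := hd.nonempty
  choose! α β γ hαβ using fun i hi => hquad i hi 0 v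
  have key := eq_zero_of_sum_mul_exp_quadratic_eq_zero (s := s) (α := α) (β := β)
    (a := fun i => c i * Real.exp (γ i)) ?_ ?_
  · intro i hi
    exact (mul_eq_zero.1 (key i hi)).resolve_right (Real.exp_ne_zero _)
  · intro i hi j hj h1 h2
    by_contra hij
    have hvij := Set.mem_iInter₂.1 hv (i, j) (by simp [hi, hj, hij])
    apply hvij
    have a1 := hαβ i hi 0
    have a2 := hαβ j hj 0
    have a3 := hαβ i hi 1
    have a4 := hαβ j hj 1
    simp only [zero_smul, one_smul, zero_add, add_zero] at a1 a2 a3 a4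
    simp only []
    rw [a1, a2, a3, a4, h1, h2]; ring
  · intro t
    rw [← hall (0 + t • v)]
    refine Finset.sum_congr rfl fun i hi => ?_
    rw [hαβ i hi t, Real.exp_add _ (γ i)]; ring

/-! ### Densities and null sets of degenerate Gaussians -/

/-- The standard Gaussian measure has density proportional to `exp (-‖x‖² / 2)`. -/
theorem exists_stdGaussian_eq_withDensity (V : Type*) [NormedAddCommGroup V]
    [InnerProductSpace ℝ V] [FiniteDimensional ℝ V] [MeasurableSpace V] [BorelSpace V] :
    ∃ κ : ℝ, 0 < κ ∧ stdGaussian V =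
      volume.withDensity fun x => ENNReal.ofReal (κ * Real.exp (-(‖x‖ ^ 2 / 2))) := by
  set d : ℝ := Module.finrank ℝ V / 2 with hd
  have hpos : 0 < (2 * Real.pi) ^ d := by positivity
  have hint : Integrable (fun x : V => Real.exp (-(‖x‖ ^ 2 / 2))) := by
    have h := GaussianFourier.integral_rexp_neg_mul_sq_norm (V := V) (b := 1 / 2) (by norm_num)
    -- A non-integrable function has integral 0 by convention, but the Gaussian integral is
    -- positive.
    by_contra hni
    have h0 : ∫ x : V, Real.exp (-(1 / 2) * ‖x‖ ^ 2) = 0 := by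
      rw [← integral_undef hni]
      congr with x; ring_nf
    rw [h0] at h
    have : 0 < (Real.pi / (1 / 2)) ^ ((Module.finrank ℝ V : ℝ) / 2) := by positivity
    exact this.ne h
  refine ⟨((2 * Real.pi) ^ d)⁻¹, inv_pos.2 hpos, ?_⟩
  have : IsFiniteMeasure ((volume : Measure V).withDensity fun x =>
      ENNReal.ofReal (((2 * Real.pi) ^ d)⁻¹ * Real.exp (-(‖x‖ ^ 2 / 2)))) :=
    isFiniteMeasure_withDensity_ofReal (hint.const_mul _).2
  refine Measure.ext_of_charFun (funext fun t => ?_)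
  rw [charFun_stdGaussian, charFun_apply,
    integral_withDensity_eq_integral_toReal_smul (by fun_prop) (by simp)]
  have hrw : ∀ x : V, (ENNReal.ofReal (((2 * Real.pi) ^ d)⁻¹ *
      Real.exp (-(‖x‖ ^ 2 / 2)))).toReal • Complex.exp (⟪x, t⟫ * Complex.I) =
      ((((2 * Real.pi) ^ d)⁻¹ : ℝ) : ℂ) *
        Complex.exp (-(1 / 2) * ‖x‖ ^ 2 + Complex.I * ⟪t, x⟫) := by
    intro x
    rw [ENNReal.toReal_ofReal (by positivity), Complex.real_smul, Complex.ofReal_mul, mul_assoc,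
      Complex.ofReal_exp, ← Complex.exp_add, real_inner_comm]
    congr 2
    push_cast; ring
  simp_rw [hrw]
  rw [integral_const_mul, GaussianFourier.integral_cexp_neg_mul_sq_norm_add (by norm_num)]
  have hc : ((Real.pi : ℂ) / (1 / 2)) ^ ((Module.finrank ℝ V : ℂ) / 2) =
      (((2 * Real.pi) ^ d : ℝ) : ℂ) := by
    rw [Complex.ofReal_cpow (by positivity), hd]
    push_cast
    congr 1; ring
  rw [hc, ← mul_assoc, ← Complex.ofReal_mul, inv_mul_cancel₀ hpos.ne', Complex.ofReal_one, one_mul,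
    Complex.I_sq]
  congr 1; ring

section AffineImage

variable {E : Type*} [NormedAddCommGroup E] [InnerProductSpace ℝ E] [FiniteDimensional ℝ E]
  [MeasurableSpace E] [BorelSpace E]

/-- The image of the standard Gaussian measure under `x ↦ m + T x`, where `T` is symmetric, only
involves the restriction of `T` to its range. -/
theorem map_stdGaussian_eq_map_range (m : E) {T : E →L[ℝ] E} (hT : T.toLinearMap.IsSymmetric)
    {V : Submodule ℝ E} (hV : T.toLinearMap.range = V) :
    (stdGaussian E).map (fun x => m + T x) = (stdGaussian V).map (fun v : V => m + T v) := by
  have : IsProbabilityMeasure ((stdGaussian E).map (fun x => m + T x)) :=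
    Measure.isProbabilityMeasure_map (by fun_prop)
  have : IsProbabilityMeasure ((stdGaussian V).map (fun v : V => m + T v)) :=
    Measure.isProbabilityMeasure_map (by fun_prop)
  refine Measure.ext_of_charFun (funext fun t => ?_)
  -- By symmetry of `T`, up to the common phase from `m`, both characteristic functions at `t`
  -- depend only on the norm of `T t`, which lies in `V`.
  have hmem : T t ∈ V := hV ▸ LinearMap.mem_range_self T.toLinearMap t
  have h1 : charFun ((stdGaussian E).map (fun x => m + T x)) t =
      charFun (stdGaussian E) (T t) * Complex.exp (⟪m, t⟫ * Complex.I) := by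
    rw [charFun_apply, charFun_apply, integral_map (by fun_prop) (by fun_prop),
      ← integral_mul_const]
    congr with x
    rw [← Complex.exp_add, inner_add_left, show ⟪T x, t⟫ = ⟪x, T t⟫ from hT x t]
    push_cast; ring_nf
  have h2 : charFun ((stdGaussian V).map (fun v : V => m + T v)) t =
      charFun (stdGaussian V) ⟨T t, hmem⟩ * Complex.exp (⟪m, t⟫ * Complex.I) := by
    rw [charFun_apply, charFun_apply, integral_map (by fun_prop) (by fun_prop),
      ← integral_mul_const]
    congr with x
    rw [← Complex.exp_add, inner_add_left, show ⟪T x, t⟫ = ⟪(x : E), T t⟫ from hT x t,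
      Submodule.coe_inner]
    push_cast; ring_nf
  rw [h1, h2, charFun_stdGaussian, charFun_stdGaussian, Submodule.coe_norm]

/-- A degenerate Gaussian measure has a Gaussian density on its supporting affine subspace. -/
theorem exists_density_map_stdGaussian (a m : E) {T : E →L[ℝ] E}
    (hT : T.toLinearMap.IsSymmetric) {V : Submodule ℝ E} (hV : T.toLinearMap.range = V)
    (hm : m - a ∈ V) :
    ∃ (κ : ℝ) (R : V →L[ℝ] V) (u : V), 0 < κ ∧
      Integrable (fun v : V => κ * Real.exp (-(‖R (v - u)‖ ^ 2 / 2))) ∧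
      ∀ C : Set E, MeasurableSet C → ((stdGaussian E).map fun x => m + T x).real C =
        ∫ v in {v : V | a + v ∈ C}, κ * Real.exp (-(‖R (v - u)‖ ^ 2 / 2)) := by
  obtain ⟨κ, hκ, hstd⟩ := exists_stdGaussian_eq_withDensity V
  have hmem : ∀ x, T x ∈ V := fun x => hV ▸ LinearMap.mem_range_self T.toLinearMap x
  -- A symmetric map is injective on its range: if `v = T w` and `T v = 0`, then `⟪v, v⟫ = ⟪w, T v⟫
  -- = 0`.
  have hinj : Function.Injective ((T.toLinearMap ∘ₗ V.subtype).codRestrict V fun v => hmem v) := by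
    rw [← LinearMap.ker_eq_bot, LinearMap.ker_eq_bot']
    rintro ⟨v, hv⟩ h
    have hTv : T v = 0 := congrArg Subtype.val h
    rw [← hV] at hv
    obtain ⟨w, hw⟩ := hv
    have : ⟪v, v⟫ = 0 := by
      nth_rewrite 1 [← hw]
      rw [hT w v]
      simp [hTv]
    exact Subtype.ext (inner_self_eq_zero.1 this)
  let e : V ≃L[ℝ] V := (LinearEquiv.ofInjectiveEndo _ hinj).toContinuousLinearEquiv
  have he : ∀ v : V, (e v : E) = T v := fun v => rfl
  let u : V := ⟨m - a, hm⟩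
  let Φ : V ≃ₜ V := e.toHomeomorph.trans (Homeomorph.addLeft u)
  have hΦ : ∀ v, Φ v = u + e v := fun v => rfl
  -- Uniqueness of Haar measure provides the Jacobian factor; only its positivity matters, so no
  -- determinant is computed.
  obtain ⟨r, hr, hvol⟩ : ∃ r : ℝ, 0 < r ∧
      (volume : Measure V).map Φ = ENNReal.ofReal r • volume := by
    have : ((volume : Measure V).map e).IsAddHaarMeasure := e.isAddHaarMeasure_map volume
    have h1 : (volume : Measure V).map Φ = (volume : Measure V).map e := by
      have : (Φ : V → V) = (fun x => u + x) ∘ e := rfl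
      rw [this, ← Measure.map_map (by fun_prop) (by fun_prop), map_add_left_eq_self]
    refine ⟨Measure.addHaarScalarFactor (volume.map e) (volume : Measure V), ?_, ?_⟩
    · exact_mod_cast Measure.addHaarScalarFactor_pos_of_isAddHaarMeasure _ _
    · rw [h1, ENNReal.ofReal_coe_nnreal]
      exact Measure.isAddLeftInvariant_eq_smul _ _
  let g : V → ℝ := fun v => κ * Real.exp (-(‖(e.symm : V →L[ℝ] V) (v - u)‖ ^ 2 / 2))
  have hg : ∀ v, g (Φ v) = κ * Real.exp (-(‖v‖ ^ 2 / 2)) := by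
    intro v; simp [g, hΦ]
  have hgstd : Integrable (fun v : V => κ * Real.exp (-(‖v‖ ^ 2 / 2))) := by
    have hfin : IsFiniteMeasure ((volume : Measure V).withDensity fun x =>
      ENNReal.ofReal (κ * Real.exp (-(‖x‖ ^ 2 / 2)))) := hstd ▸ inferInstance
    refine ⟨by fun_prop, ?_⟩
    rw [hasFiniteIntegral_iff_ofReal (ae_of_all _ fun v => by positivity), ← setLIntegral_univ,
      ← withDensity_apply _ MeasurableSet.univ]
    exact measure_lt_top _ _
  have hgint : Integrable g := by
    have : Integrable g ((volume : Measure V).map Φ) := by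
      rw [Φ.measurableEmbedding.integrable_map_iff]
      exact hgstd.congr (ae_of_all _ fun v => (hg v).symm)
    rw [hvol] at this
    exact (integrable_smul_measure (by simpa using hr) (by simp)).1 this
  have hset : ∀ C : Set E, MeasurableSet C →
      ((stdGaussian E).map fun x => m + T x).real C = r * ∫ v in {v : V | a + v ∈ C}, g v := by
    intro C hC
    have hpre : MeasurableSet ((fun v : V => m + T v) ⁻¹' C) := by
      have : Measurable fun v : V => m + T v := by fun_prop
      exact this hC
    rw [map_stdGaussian_eq_map_range m hT hV, Measure.real, Measure.map_apply (by fun_prop) hC,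
      hstd, withDensity_apply _ hpre, ← ofReal_integral_eq_lintegral_ofReal hgstd.integrableOn
        (ae_of_all _ fun v => by positivity),
      ENNReal.toReal_ofReal (integral_nonneg fun v => by positivity)]
    have h1 : r * ∫ v in {v : V | a + v ∈ C}, g v =
        ∫ v in {v : V | a + v ∈ C}, g v ∂((volume : Measure V).map Φ) := by
      rw [hvol, Measure.restrict_smul, integral_smul_measure, ENNReal.toReal_ofReal hr.le,
        smul_eq_mul]
    rw [h1, Φ.measurableEmbedding.setIntegral_map]
    have h2 : Φ ⁻¹' {v : V | a + v ∈ C} = (fun v : V => m + T v) ⁻¹' C := by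
      ext v
      have : a + (Φ v : E) = m + T v := by
        rw [hΦ, Submodule.coe_add, he]
        simp [u, ← add_assoc]
      simp [this]
    simp_rw [h2, hg]
  refine ⟨r * κ, e.symm, u, mul_pos hr hκ, ?_, fun C hC => ?_⟩
  · simp_rw [mul_assoc]
    exact hgint.const_mul r
  · rw [hset C hC, ← integral_const_mul]
    simp_rw [g, mul_assoc]

/-- A Gaussian measure gives no mass to an affine subspace not containing its support. -/
theorem map_stdGaussian_affineSubspace_eq_zero (m : E) (T : E →L[ℝ] E) (A : AffineSubspace ℝ E)
    (hA : ∃ x, m + T x ∉ A) : (stdGaussian E).map (fun x => m + T x) A = 0 := by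
  obtain ⟨x, hx⟩ := hA
  have hclosed : IsClosed (A : Set E) := A.closed_of_finiteDimensional
  rw [Measure.map_apply (by fun_prop) hclosed.measurableSet]
  let f : E →ᵃ[ℝ] E := T.toLinearMap.toAffineMap + AffineMap.const ℝ E m
  have hf : (fun x => m + T x) ⁻¹' (A : Set E) = (A.comap f : Set E) := by
    ext y; simp [f, add_comm]
  have hac : stdGaussian E ≪ volume := by
    obtain ⟨κ, -, h⟩ := exists_stdGaussian_eq_withDensity E
    rw [h]
    exact withDensity_absolutelyContinuous _ _
  rw [hf]
  -- The preimage of `A` is an affine subspace that misses `x`, hence proper and Lebesgue-null.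
  refine hac (Measure.addHaar_affineSubspace _ _ fun htop => hx ?_)
  have : x ∈ A.comap f := htop ▸ AffineSubspace.mem_top ℝ E x
  simpa [f, add_comm] using this

end AffineImage

/-! ### Signed combinations of Gaussians vanishing on an open set -/

section SignedMixture

variable {E : Type*} [NormedAddCommGroup E] [InnerProductSpace ℝ E] [FiniteDimensional ℝ E]
  [MeasurableSpace E] [BorelSpace E] {κ : Type*} {s : Finset κ} {m : κ → E} {T : κ → E →L[ℝ] E}
  {c : κ → ℝ} {U : Set E}

/-- A linear combination of distinct Gaussian measures with a common supporting affine subspace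
`a + V` that vanishes on an open set meeting `a + V` is trivial. -/
theorem eq_zero_of_sum_map_stdGaussian_eq_zero_of_range_eq
    (hT : ∀ i ∈ s, (T i).toLinearMap.IsSymmetric)
    (hinj : ∀ i ∈ s, ∀ j ∈ s, (stdGaussian E).map (fun x => m i + T i x) =
      (stdGaussian E).map (fun x => m j + T j x) → i = j)
    {V : Submodule ℝ E} {a : E} (hV : ∀ i ∈ s, (T i).toLinearMap.range = V)
    (hm : ∀ i ∈ s, m i - a ∈ V) (hU : IsOpen U) (hne : ∃ v ∈ V, a + v ∈ U)
    (h : ∀ C : Set E, MeasurableSet C →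
      ∑ i ∈ s, c i * ((stdGaussian E).map fun x => m i + T i x).real (C ∩ U) = 0) :
    ∀ i ∈ s, c i = 0 := by
  have hdens := fun i hi => exists_density_map_stdGaussian a (m i) (hT i hi) (hV i hi) (hm i hi)
  choose! k R u hk hint hN using hdens
  let q : κ → V → ℝ := fun i v => -(‖R i (v - u i)‖ ^ 2 / 2)
  have hadd : Measurable fun v : V => a + (v : E) := by fun_prop
  have hemb : MeasurableEmbedding fun v : V => a + (v : E) :=
    (measurableEmbedding_addLeft a).comp
      (MeasurableEmbedding.subtype_coe V.closed_of_finiteDimensional.measurableSet)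
  have hU' : IsOpen {v : V | a + (v : E) ∈ U} := by
    have hcont : Continuous fun v : V => a + (v : E) := by fun_prop
    exact hU.preimage hcont
  have hfint : Integrable fun v => ∑ i ∈ s, c i * (k i * Real.exp (q i v)) :=
    integrable_finsetSum s fun i hi => (hint i hi).const_mul (c i)
  -- Testing `h` on the sets `a + D` makes the combined density integrate to zero over every
  -- measurable part of the slice of `U`; continuity later removes the "almost everywhere".
  have hae : (fun v => ∑ i ∈ s, c i * (k i * Real.exp (q i v)))
      =ᵐ[volume.restrict {v : V | a + (v : E) ∈ U}] 0 := by
    refine hfint.restrict.ae_eq_zero_of_forall_setIntegral_eq_zero fun D hD _ => ?_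
    rw [Measure.restrict_restrict hD, integral_finsetSum s
      fun i hi => ((hint i hi).const_mul (c i)).integrableOn]
    rw [← h _ (hemb.measurableSet_image.2 hD)]
    refine Finset.sum_congr rfl fun i hi => ?_
    rw [integral_const_mul, hN i hi _ ((hemb.measurableSet_image.2 hD).inter hU.measurableSet)]
    have hset : {v : V | a + (v : E) ∈ (fun v : V => a + (v : E)) '' D ∩ U} =
        D ∩ {v : V | a + (v : E) ∈ U} := by
      ext v
      simp only [Set.mem_inter_iff, Set.mem_ofPred_eq]
      rw [hemb.injective.mem_set_image (s := D) (a := v)]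
    rw [hset]
  have hcont : Continuous fun v => ∑ i ∈ s, c i * (k i * Real.exp (q i v)) := by
    simp only [q]; fun_prop
  have hzero := Measure.eqOn_open_of_ae_eq hae hU' hcont.continuousOn continuousOn_const
  have key := eq_zero_of_sum_mul_exp_eq_zero_on_open (s := s) (q := q) (c := fun i => c i * k i)
    ?_ ?_ ?_ hU' ?_ ?_
  · exact fun i hi => (mul_eq_zero.1 (key i hi)).resolve_right (hk i hi).ne'
  · intro i _
    have : ContDiff ℝ ⊤ (q i) := by
      have h1 : ContDiff ℝ ⊤ fun v : V => R i (v - u i) :=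
        (R i).contDiff.comp (contDiff_id.sub contDiff_const)
      exact ((h1.norm_sq ℝ).div_const 2).neg
    exact contDiff_omega_iff_analyticOnNhd.1 this
  · intro i _ x v
    refine ⟨-(‖R i v‖ ^ 2 / 2), -⟪R i (x - u i), R i v⟫, -(‖R i (x - u i)‖ ^ 2 / 2), fun t => ?_⟩
    have : x + t • v - u i = (x - u i) + t • v := by abel
    simp only [q]
    rw [this, map_add, map_smul, norm_add_sq_real, inner_smul_right, norm_smul, mul_pow,
      Real.norm_eq_abs, sq_abs]
    ring
  · intro i hi j hj hij
    by_contra! hconst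
    apply hij
    apply hinj i hi j hj
    -- Exponents differing by a constant make the two measures proportional with ratio `ρ`;
    -- comparing total masses forces `ρ = 1`.
    set ρ := k i / k j * Real.exp (q i 0 - q j 0) with hρ
    have hprop : ∀ C : Set E, MeasurableSet C →
        ((stdGaussian E).map fun x => m i + T i x).real C =
          ρ * ((stdGaussian E).map fun x => m j + T j x).real C := by
      intro C hC
      rw [hN i hi C hC, hN j hj C hC, ← integral_const_mul]
      congr with v
      change k i * Real.exp (q i v) = ρ * (k j * Real.exp (q j v))
      have hqv : q i v = (q i 0 - q j 0) + q j v := by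
        rw [← hconst v 0]; ring
      have hkj := (hk j hj).ne'
      rw [hqv, Real.exp_add, hρ]
      field_simp
    have : IsProbabilityMeasure ((stdGaussian E).map fun x => m i + T i x) :=
      Measure.isProbabilityMeasure_map (by fun_prop)
    have : IsProbabilityMeasure ((stdGaussian E).map fun x => m j + T j x) :=
      Measure.isProbabilityMeasure_map (by fun_prop)
    have hone : ρ = 1 := by
      have := hprop Set.univ MeasurableSet.univ
      simpa using this.symm
    ext C hC
    rw [← measureReal_eq_measureReal_iff, hprop C hC, hone, one_mul]
  · obtain ⟨v, hv, hvU⟩ := hne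
    exact ⟨⟨v, hv⟩, hvU⟩
  · intro v hv
    rw [← show _ = (0 : ℝ) from hzero hv]
    exact Finset.sum_congr rfl fun i _ => mul_assoc _ _ _

/-- If a linear combination of distinct, possibly degenerate Gaussian measures vanishes on an open
set, then the coefficient of each one whose supporting affine subspace meets that set is zero. -/
theorem eq_zero_of_sum_map_stdGaussian_eq_zero
    (hT : ∀ i ∈ s, (T i).toLinearMap.IsSymmetric)
    (hinj : ∀ i ∈ s, ∀ j ∈ s, (stdGaussian E).map (fun x => m i + T i x) =
      (stdGaussian E).map (fun x => m j + T j x) → i = j)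
    (hU : IsOpen U)
    (h : ∀ C : Set E, MeasurableSet C →
      ∑ i ∈ s, c i * ((stdGaussian E).map fun x => m i + T i x).real (C ∩ U) = 0)
    {j : κ} (hj : j ∈ s) (hne : ∃ x, m j + T j x ∈ U) : c j = 0 := by
  classical
  let A : κ → AffineSubspace ℝ E := fun i => AffineSubspace.mk' (m i) (T i).toLinearMap.range
  have hA : ∀ i x, m i + T i x ∈ A i := fun i x => by
    simp [A, AffineSubspace.mem_mk']
  have hAsub : ∀ i (A' : AffineSubspace ℝ E), (∀ x, m i + T i x ∈ A') → A i ≤ A' := by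
    intro i A' hx y hy
    obtain ⟨x, hx'⟩ := AffineSubspace.mem_mk'.1 hy
    have hx'' : T i x = y - m i := hx'
    have := hx x
    rwa [hx'', add_sub_cancel] at this
  have hAmeas : ∀ i, MeasurableSet (A i : Set E) :=
    fun i => (A i).closed_of_finiteDimensional.measurableSet
  have hcompl : ∀ i, ((stdGaussian E).map fun x => m i + T i x) (A i : Set E)ᶜ = 0 := by
    intro i
    rw [Measure.map_apply (by fun_prop) (hAmeas i).compl]
    have : (fun x => m i + T i x) ⁻¹' (A i : Set E)ᶜ = ∅ := by
      ext x; simpa using hA i x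
    rw [this, measure_empty]
  have hnull : ∀ i (A' : AffineSubspace ℝ E), ¬ A i ≤ A' →
      ((stdGaussian E).map fun x => m i + T i x) A' = 0 := by
    intro i A' hi
    refine map_stdGaussian_affineSubspace_eq_zero _ _ _ ?_
    by_contra! hx
    exact hi (hAsub i A' hx)
  let S := s.filter fun i => A i < A j
  -- `B` has full measure for the components with `A i = A j` and measure zero for all others: those
  -- with `A i < A j` live on a removed set, and those with `A i` not inside `A j` do not charge `A
  -- j`.
  let B : Set E := (A j : Set E) \ ⋃ i ∈ S, (A i : Set E)
  have hBmeas : MeasurableSet B :=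
    (hAmeas j).diff (S.measurableSet_biUnion fun i _ => hAmeas i)
  refine eq_zero_of_sum_map_stdGaussian_eq_zero_of_range_eq (s := s.filter fun i => A i = A j)
    (m := m) (T := T) (V := (T j).toLinearMap.range) (a := m j) (U := U) ?_ ?_ ?_ ?_ hU ?_ ?_ j
    (by simp [hj])
  · exact fun i hi => hT i (Finset.mem_filter.1 hi).1
  · exact fun i hi k hk => hinj i (Finset.mem_filter.1 hi).1 k (Finset.mem_filter.1 hk).1
  · intro i hi
    have := congrArg AffineSubspace.direction (Finset.mem_filter.1 hi).2
    simpa [A] using this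
  · intro i hi
    have h1 : m i ∈ A j := by
      rw [← (Finset.mem_filter.1 hi).2]
      simpa using hA i 0
    exact AffineSubspace.mem_mk'.1 h1
  · obtain ⟨x, hx⟩ := hne
    exact ⟨T j x, LinearMap.mem_range_self _ x, hx⟩
  · intro C hC
    rw [Finset.sum_filter]
    refine (Finset.sum_congr rfl fun i hi => ?_).trans (h (C ∩ B) (hC.inter hBmeas))
    split_ifs with hij
    · congr 1
      refine measureReal_congr ?_
      have hB : B ∈ ae ((stdGaussian E).map fun x => m i + T i x) := by
        rw [mem_ae_iff, show B = (A j : Set E) \ ⋃ i ∈ S, (A i : Set E) from rfl, Set.sdiff_eq, Set.compl_inter, compl_compl]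
        refine measure_union_null (hij ▸ hcompl i) ?_
        refine (measure_biUnion_null_iff S.countable_toSet).2 fun k hk => hnull i (A k) ?_
        rw [hij]
        exact (Finset.mem_filter.1 hk).2.not_ge
      filter_upwards [hB] with x hx
      have hx' : x ∈ B := hx
      exact propext ⟨fun h => ⟨⟨h.1, hx'⟩, h.2⟩, fun h => ⟨h.1.1, h.2⟩⟩
    · have hB : ((stdGaussian E).map fun x => m i + T i x) B = 0 := by
        by_cases hle : A i ≤ A j
        · refine measure_mono_null (fun x (hx : x ∈ B) => ?_) (hcompl i)
          intro hxi
          exact hx.2 <| Set.mem_biUnion (Finset.mem_coe.2 (Finset.mem_filter.2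
            ⟨hi, lt_of_le_of_ne hle hij⟩)) hxi
        · exact measure_mono_null Set.sdiff_subset (hnull i (A j) hle)
      have : ((stdGaussian E).map fun x => m i + T i x) (C ∩ B ∩ U) = 0 :=
        measure_mono_null (fun x hx => hx.1.2) hB
      rw [Measure.real, this, ENNReal.toReal_zero, mul_zero]

end SignedMixture

/-! ### Passage to means and covariance matrices -/

/-- A multivariate Gaussian measure is the image of the standard one under an affine map with
symmetric linear part. -/
theorem exists_isSymmetric_multivariateGaussian_eq_map {ι : Type*} [Fintype ι] [DecidableEq ι]
    (m : EuclideanSpace ℝ ι) (S : Matrix ι ι ℝ) :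
    ∃ T : EuclideanSpace ℝ ι →L[ℝ] EuclideanSpace ℝ ι, T.toLinearMap.IsSymmetric ∧
      multivariateGaussian m S = (stdGaussian (EuclideanSpace ℝ ι)).map fun x => m + T x := by
  open scoped MatrixOrder Matrix.Norms.L2Operator in
  refine ⟨Matrix.toEuclideanCLM (𝕜 := ℝ) (CFC.sqrt S), ?_, rfl⟩
  rw [← ContinuousLinearMap.isSelfAdjoint_iff_isSymmetric]
  exact (CFC.sqrt_nonneg S).isSelfAdjoint.map _

/-- The mean and the covariance matrix of a Gaussian measure are determined by the measure. -/
theorem multivariateGaussian_injective {ι : Type*} [Fintype ι] [DecidableEq ι]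
    {m m' : EuclideanSpace ℝ ι} {S S' : Matrix ι ι ℝ} (hS : S.PosSemidef) (hS' : S'.PosSemidef)
    (h : multivariateGaussian m S = multivariateGaussian m' S') : m = m' ∧ S = S' := by
  constructor
  · rw [← integral_id_multivariateGaussian (μ := m) (S := S), h, integral_id_multivariateGaussian]
  · ext i j
    rw [← covariance_eval_multivariateGaussian (μ := m) hS, h,
      covariance_eval_multivariateGaussian hS']

/-- Linear independence on an open set of Gaussian measures whose support meets that set, for a
finite family of parameters that may have repetitions. -/
theorem sum_coeff_eq_zero_of_sum_multivariateGaussian_eq_zero {ι κ : Type*} [Fintype ι]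
    [DecidableEq ι] [Fintype κ] [DecidableEq (EuclideanSpace ℝ ι × Matrix ι ι ℝ)]
    {p : κ → EuclideanSpace ℝ ι × Matrix ι ι ℝ} (hp : ∀ k, (p k).2.PosSemidef) {c : κ → ℝ}
    {U : Set (EuclideanSpace ℝ ι)} (hU : IsOpen U)
    (h : ∀ C, MeasurableSet C →
      ∑ k, c k * (multivariateGaussian (p k).1 (p k).2).real (C ∩ U) = 0)
    {k₀ : κ} (hk₀ : ((multivariateGaussian (p k₀).1 (p k₀).2).support ∩ U).Nonempty) :
    ∑ k with p k = p k₀, c k = 0 := by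
  choose T hT hN using fun a : EuclideanSpace ℝ ι × Matrix ι ι ℝ =>
    exists_isSymmetric_multivariateGaussian_eq_map a.1 a.2
  -- Repeated parameters are merged by indexing over the image of `p`, with the sum over each fibre
  -- as coefficient.
  refine eq_zero_of_sum_map_stdGaussian_eq_zero (s := Finset.univ.image p) (m := Prod.fst) (T := T)
    (c := fun a => ∑ k with p k = a, c k) (fun a _ => hT a) ?_ hU ?_
    (Finset.mem_image_of_mem p (Finset.mem_univ k₀)) ?_
  · simp only [← hN]
    intro a ha b hb hab
    obtain ⟨k, -, rfl⟩ := Finset.mem_image.1 ha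
    obtain ⟨l, -, rfl⟩ := Finset.mem_image.1 hb
    have := multivariateGaussian_injective (hp k) (hp l) hab
    exact Prod.ext this.1 this.2
  · intro C hC
    simp only [← hN]
    rw [← h C hC, ← Finset.sum_fiberwise_of_maps_to
      (fun k _ => Finset.mem_image_of_mem p (Finset.mem_univ k))]
    refine Finset.sum_congr rfl fun a _ => ?_
    rw [Finset.sum_mul]
    refine Finset.sum_congr rfl fun k hk => ?_
    rw [(Finset.mem_filter.1 hk).2]
  · obtain ⟨x, hx, hxU⟩ := hk₀
    rw [hN] at hx
    -- If no point `m + T x` lay in `U`, then `U` would be null, contradicting that it is a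
    -- neighbourhood of a support point.
    by_contra! hnone
    rw [Measure.mem_support_iff_forall] at hx
    refine (hx U (hU.mem_nhds hxU)).ne' ?_
    rw [Measure.map_apply (by fun_prop) hU.measurableSet]
    convert measure_empty (μ := stdGaussian (EuclideanSpace ℝ ι))
    ext y; simpa using hnone y

/-! ### Identifiability of mixtures -/

namespace PdGMM

variable {n : ℕ}

theorem law_real_apply (P : PdGMM n) (C : Set (EuclideanSpace ℝ (Fin n))) :
    P.law.real C = ∑ j, P.weight j * (multivariateGaussian (P.mean j) (P.cov j)).real C := by
  rw [law, Measure.real, Measure.finsetSum_apply, ENNReal.toReal_sum]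
  · refine Finset.sum_congr rfl fun j _ => ?_
    rw [Measure.smul_apply, smul_eq_mul, ENNReal.toReal_mul,
      ENNReal.toReal_ofReal (P.weight_pos j).le]
    rfl
  · intro j _
    rw [Measure.smul_apply, smul_eq_mul]
    refine ENNReal.mul_ne_top ENNReal.ofReal_ne_top ?_
    rw [component]
    exact measure_ne_top _ _

end PdGMM

theorem mainTheorem1 {n : ℕ} (P Q : PdGMM n) (hP : P.IsReduced) (hQ : Q.IsReduced)
    (hPrank : ∀ j, 0 < (P.cov j).rank) (hQrank : ∀ j, 0 < (Q.cov j).rank)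
    (E : Set (EuclideanSpace ℝ (Fin n))) (hE : IsOpen E)
    (hmeet : ∀ j, ((P.component j).support ∩ E).Nonempty)
    (hPQ : P.law.restrict E = Q.law.restrict E) :
    P.law = Q.law ∧ P.J = Q.J ∧
      ∃ π : Fin P.J ≃ Fin Q.J, ∀ j,
        P.weight j = Q.weight (π j) ∧ P.mean j = Q.mean (π j) ∧ P.cov j = Q.cov (π j) := by
  classical
  let pP : Fin P.J → EuclideanSpace ℝ (Fin n) × Matrix (Fin n) (Fin n) ℝ :=
    fun j => (P.mean j, P.cov j)
  let pQ : Fin Q.J → EuclideanSpace ℝ (Fin n) × Matrix (Fin n) (Fin n) ℝ :=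
    fun j => (Q.mean j, Q.cov j)
  have hPinj : Function.Injective pP := fun i j hij => by_contra fun hne => hP i j hne hij
  have hQinj : Function.Injective pQ := fun i j hij => by_contra fun hne => hQ i j hne hij
  have hsum : ∀ j, P.weight j = ∑ k with pQ k = pP j, Q.weight k := by
    intro j
    -- The family is the disjoint union of both parameter lists, the weights of `Q` taken
    -- negatively. Since `P` is reduced, only index `j` of `P` lies in the fibre.
    have h := sum_coeff_eq_zero_of_sum_multivariateGaussian_eq_zero (p := Sum.elim pP pQ)
      (c := Sum.elim P.weight fun k => -Q.weight k) (U := E) (k₀ := Sum.inl j)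
      (by rintro (j | k); exacts [P.cov_posSemidef j, Q.cov_posSemidef k]) hE ?_ (hmeet j)
    · rw [Finset.sum_filter, Fintype.sum_sum_type] at h
      simp only [Sum.elim_inl, Sum.elim_inr, hPinj.eq_iff, Finset.sum_ite_eq', Finset.mem_univ,
        if_true] at h
      have h' : P.weight j + ∑ k, (if pQ k = pP j then -Q.weight k else 0) = 0 := by
        convert h using 3
        exact if_congr Iff.rfl rfl rfl
      rw [← Finset.sum_filter, Finset.sum_neg_distrib] at h'
      linarith
    · intro C hC
      have hCE : P.law.real (C ∩ E) = Q.law.real (C ∩ E) := by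
        rw [Measure.real, Measure.real, ← Measure.restrict_apply hC, hPQ,
          Measure.restrict_apply hC]
      rw [P.law_real_apply, Q.law_real_apply] at hCE
      simp only [Fintype.sum_sum_type, Sum.elim_inl, Sum.elim_inr, neg_mul,
        Finset.sum_neg_distrib, pP, pQ]
      linarith
  have hex : ∀ j, ∃ k, pQ k = pP j := by
    intro j
    by_contra! hno
    have := hsum j
    rw [Finset.filter_false_of_mem fun k _ => hno k, Finset.sum_empty] at this
    exact (P.weight_pos j).ne' this
  choose π hπ using hex
  have hw : ∀ j, P.weight j = Q.weight (π j) := by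
    intro j
    have : Finset.univ.filter (fun k => pQ k = pP j) = {π j} := by
      ext k
      rw [Finset.mem_filter, ← hπ j, hQinj.eq_iff]
      simp
    rw [hsum j, this, Finset.sum_singleton]
  have hπinj : Function.Injective π := fun i j hij => hPinj (by rw [← hπ i, ← hπ j, hij])
  -- The matched components of `Q` already carry total weight 1, so an unmatched one, having
  -- positive weight, would push the sum above 1.
  have hπsurj : Function.Surjective π := by
    intro k
    by_contra! hk
    have h1 : ∑ l ∈ Finset.univ.image π, Q.weight l = 1 := by
      rw [Finset.sum_image hπinj.injOn, ← P.sum_weight]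
      exact Finset.sum_congr rfl fun j _ => (hw j).symm
    have h2 : ∑ l ∈ Finset.univ.image π, Q.weight l < ∑ l, Q.weight l :=
      Finset.sum_lt_sum_of_subset (Finset.subset_univ _) (Finset.mem_univ k) (by simpa using hk)
        (Q.weight_pos k) fun l _ _ => (Q.weight_pos l).le
    rw [h1, Q.sum_weight] at h2
    exact lt_irrefl _ h2
  let e : Fin P.J ≃ Fin Q.J := Equiv.ofBijective π ⟨hπinj, hπsurj⟩
  have he : ∀ j, P.weight j = Q.weight (e j) ∧ P.mean j = Q.mean (e j) ∧ P.cov j = Q.cov (e j) :=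
    fun j => ⟨hw j, (congrArg Prod.fst (hπ j)).symm, (congrArg Prod.snd (hπ j)).symm⟩
  refine ⟨?_, by simpa using Fintype.card_congr e, e, he⟩
  rw [PdGMM.law, PdGMM.law, ← Equiv.sum_comp e]
  refine Finset.sum_congr rfl fun j _ => ?_
  rw [PdGMM.component, PdGMM.component, (he j).1, (he j).2.1, (he j).2.2]
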